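/- Let $F$ be a finite field, let $r$ be a positive integer, and let $\alpha\in F$ be a nonzero element of multiplicative order at least $r$. Let $\ell\ge 0$ and let $\mu_0,\dots,\mu_\ell$ be positive integers with $\sum_{i=0}^{\ell}\mu_i=r$; put $\tau_i=r-\mu_i$. For $\beta=(\beta_0,\dots,\beta_\ell)$ and $0\le i\le\ell$ write $$M_i(x;\beta_i)=\prod_{j=0}^{\tau_i-1}(x-\beta_i\alpha^j)=\sum_{j=0}^{\tau_i}M_{i,j}\,x^j ,$$ and let $A_i(\beta_i)$ be the $\mu_i\times r$ matrix whose entry in row $s$ and column $j$ ($0\le s<\mu_i$, $0\le j<r$) is $M_{i,j-s}$ if $0\le j-s\le\tau_i$ and $0$ otherwise. Let $A(\beta)$ be the $r\times r$ matrix obtained by stacking $A_0(\beta_0),A_1(\beta_1),\dots,A_\ell(\beta_\ell)$ from top to bottom. Then there is a nonzero constant $\kappa(\alpha)\in F$, not depending on $\beta$, such that $$\det A(\beta)=\kappa(\alpha)\prod_{0\le i<k\le\ell}\ \prod_{s=0}^{\mu_i-1}\ \prod_{t=0}^{\mu_k-1}\bigl(\beta_k\alpha^s-\beta_i\alpha^t\bigr)$$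 for all vectors $\beta$ of nonzero elements of $F$; moreover, with the same constant $\kappa(\alpha)$, this identity holds in the polynomial ring $F[\beta_0,\dots,\beta_\ell]$ when $\beta_0,\dots,\beta_\ell$ are regarded as indeterminates. -/

import Mathlib

open Polynomial

noncomputable section

/-- The polynomial `M(x; b) = ∏_{0 ≤ j < τ} (x - b α ^ j)` in the indeterminate `x`. -/
def burstPoly {R : Type*} [CommRing R] (α b : R) (τ : ℕ) : R[X] :=
  ∏ j ∈ Finset.range τ, (X - C (b * α ^ j))

/-- The `m × r` echelon matrix whose row `s` is the coefficient sequence of `M(x; b)`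
(with `τ = r - m`), shifted `s` places to the right and padded by zeros. -/
def echelonBlock {R : Type*} [CommRing R] (α b : R) (r m : ℕ) : Matrix (Fin m) (Fin r) R :=
  Matrix.of fun s j =>
    if (s : ℕ) ≤ (j : ℕ) then (burstPoly α b (r - m)).coeff ((j : ℕ) - (s : ℕ)) else 0

/-- The `r × r` matrix obtained by stacking the blocks for `i = 0, 1, …, l` from top to bottom:
row `μ 0 + ⋯ + μ (i - 1) + s` (with `s < μ i`) is row `s` of the block with index `i`. -/
def stackedMatrix {R : Type*} [CommRing R] {l r : ℕ} (μ : Fin (l + 1) → ℕ)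
    (hμ : ∑ i, μ i = r) (α : R) (β : Fin (l + 1) → R) : Matrix (Fin r) (Fin r) R :=
  Matrix.of fun a =>
    let p := finSigmaFinEquiv.symm (Fin.cast hμ.symm a)
    echelonBlock α (β p.1) r (μ p.1) p.2

end

/-! The rows of block `i` are `x^s M_i`, a basis of the multiples of `M_i` of degree below `r`.
Another basis is `burstPoly α (β_i α^(-t)) (r - 1)` for `t < μ_i`, whose cofactors over `M_i` form
an invertible matrix. By homogeneity the coefficients of `burstPoly α c (r - 1)` are fixed nonzero
constants times powers of `c`, so this change of rows (`cofactorMatrix_mul_stackedMatrix`) turns the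
stacked matrix into a Vandermonde matrix in the points `β_i α^(-t)`, up to reversing and scaling
columns. Pairs of points in different blocks give the stated product. Pairs in the same block give
powers of the `β_i`, which cancel against those in the cofactor determinants. -/

/-! ### Coefficients of the burst polynomials -/

theorem burstPoly_monic {R : Type*} [CommRing R] (q b : R) (n : ℕ) : (burstPoly q b n).Monic :=
  monic_prod_of_monic _ _ fun _ _ => monic_X_sub_C _

theorem burstPoly_natDegree {R : Type*} [CommRing R] [Nontrivial R] (q b : R) (n : ℕ) :
    (burstPoly q b n).natDegree = n := by
  unfold burstPoly
  rw [natDegree_prod_of_monic _ _ fun _ _ => monic_X_sub_C _]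
  simp only [natDegree_X_sub_C, Finset.sum_const, Finset.card_range, smul_eq_mul, mul_one]

theorem prod_X_sub_C_scaleRoots {R ι : Type*} [CommRing R] [IsDomain R] (s : Finset ι)
    (v : ι → R) (b : R) :
    (∏ j ∈ s, (X - C (v j))).scaleRoots b = ∏ j ∈ s, (X - C (b * v j)) := by
  classical
  induction s using Finset.induction_on with
  | empty => simp
  | insert i s hi ih =>
    rw [Finset.prod_insert hi, Finset.prod_insert hi, mul_scaleRoots_of_noZeroDivisors, ih,
      X_sub_C_scaleRoots, mul_comm b]

theorem burstPoly_coeff {F R : Type*} [Field F] [CommRing R] [IsDomain R] [Algebra F R]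
    (q : F) (b : R) (n j : ℕ) :
    (burstPoly (algebraMap F R q) b n).coeff j =
      algebraMap F R ((burstPoly q 1 n).coeff j) * b ^ (n - j) := by
  have h : burstPoly (algebraMap F R q) b n =
      ((burstPoly q 1 n).map (algebraMap F R)).scaleRoots b := by
    simp only [burstPoly, Polynomial.map_prod, Polynomial.map_sub, map_X, map_C, one_mul, ← map_pow,
      prod_X_sub_C_scaleRoots]
  rw [h, coeff_scaleRoots, coeff_map, natDegree_map, burstPoly_natDegree]

/-- A form of the `q`-binomial theorem: consecutive coefficients satisfy a two-term recurrence whose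
factors `q ^ (j + 1) - 1` are nonzero. -/
theorem burstPoly_coeff_ne_zero {F : Type*} [Field F] {q : F} {r : ℕ}
    (hinj : ∀ i < r, ∀ j < r, q ^ i = q ^ j → i = j) (hq : q ≠ 0) {n : ℕ} (hn : n < r) {j : ℕ}
    (hj : j ≤ n) : (burstPoly q 1 n).coeff j ≠ 0 := by
  induction hj using Nat.decreasingInduction with
  | self =>
    have := (burstPoly_monic q 1 n).coeff_natDegree
    rw [burstPoly_natDegree] at this
    simp [this]
  | of_succ j hj ih =>
    intro h0
    -- Both sides have the roots `1, q, …, q ^ n`. Scaling roots by `q` multiplies coefficient `k`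
    -- by `q ^ (n - k)`, whence the recurrence.
    have e : burstPoly q 1 n * (X - C (q ^ n)) = burstPoly q q n * (X - C 1) := by
      have h1 : burstPoly q 1 n * (X - C (q ^ n)) = burstPoly q 1 (n + 1) := by
        simp [burstPoly, Finset.prod_range_succ]
      rw [h1, burstPoly, Finset.prod_range_succ', burstPoly]
      simp [pow_succ']
    have e2 := congrArg (fun p => p.coeff (j + 1)) e
    have hs (k : ℕ) : (burstPoly q q n).coeff k = (burstPoly q 1 n).coeff k * q ^ (n - k) :=
      burstPoly_coeff (R := F) q q n k
    simp only [mul_sub, coeff_sub, coeff_mul_X, coeff_mul_C, hs, h0] at e2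
    obtain ⟨d, rfl⟩ : ∃ d, n = j + 1 + d := ⟨n - (j + 1), by omega⟩
    rw [show j + 1 + d - (j + 1) = d by omega] at e2
    have e3 : (burstPoly q 1 (j + 1 + d)).coeff (j + 1) * q ^ d * (q ^ (j + 1) - q ^ 0) = 0 := by
      rw [pow_add] at e2
      linear_combination -e2
    have := hinj (j + 1) (by omega) 0 (by omega) (by simpa [ih, hq, sub_eq_zero] using e3)
    omega

/-! ### Change of basis within one block -/

/-- The cofactor of `burstPoly q b (r - m)` in `burstPoly q (b * a ^ t) (r - 1)`,
where `a` is the inverse of `q` and `t < m`. -/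
noncomputable def burstCofactor {R : Type*} [CommRing R] (q a b : R) (r m t : ℕ) : R[X] :=
  (∏ j ∈ Finset.range t, (X - C (b * a ^ (j + 1)))) *
    ∏ j ∈ Finset.range (m - 1 - t), (X - C (b * q ^ (r - m + j)))

theorem burstCofactor_natDegree {R : Type*} [CommRing R] [Nontrivial R] (q a b : R)
    {r m t : ℕ} (ht : t < m) : (burstCofactor q a b r m t).natDegree = m - 1 := by
  unfold burstCofactor
  rw [Monic.natDegree_mul (monic_prod_of_monic _ _ fun _ _ => monic_X_sub_C _)
    (monic_prod_of_monic _ _ fun _ _ => monic_X_sub_C _),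
    natDegree_prod_of_monic _ _ fun _ _ => monic_X_sub_C _,
    natDegree_prod_of_monic _ _ fun _ _ => monic_X_sub_C _]
  simp only [natDegree_X_sub_C, Finset.sum_const, Finset.card_range, smul_eq_mul, mul_one]
  omega

/-- The roots on the right are `b q^e` for `-t ≤ e ≤ r - 2 - t`. As `t < m`, this run contains `0 ≤
e < r - m`; the cofactor collects the exponents on either side. -/
theorem burstCofactor_mul_burstPoly {R : Type*} [CommRing R] {q a : R} (hqa : q * a = 1) (b : R)
    {r m t : ℕ} (ht : t < m) (hm : m ≤ r) :
    burstCofactor q a b r m t * burstPoly q b (r - m) = burstPoly q (b * a ^ t) (r - 1) := by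
  have hpow (i : ℕ) : a ^ i * q ^ i = 1 := by rw [← mul_pow, mul_comm a, hqa, one_pow]
  have hr : r - 1 = t + (r - m) + (m - 1 - t) := by omega
  rw [burstPoly, burstPoly, hr, Finset.prod_range_add, Finset.prod_range_add,
    ← Finset.prod_range_reflect _ t, burstCofactor]
  have h1 : ∀ j ∈ Finset.range t,
      (X - C (b * a ^ t * q ^ (t - 1 - j)) : R[X]) = X - C (b * a ^ (j + 1)) := by
    intro j hj
    obtain ⟨d, rfl⟩ : ∃ d, t = j + 1 + d := ⟨t - (j + 1), by have := Finset.mem_range.1 hj; omega⟩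
    rw [show j + 1 + d - 1 - j = d by omega, pow_add, mul_assoc, mul_assoc, hpow, mul_one]
  have h2 (j : ℕ) : b * a ^ t * q ^ (t + j) = b * q ^ j := by
    rw [pow_add]; linear_combination (b * q ^ j) * hpow t
  rw [Finset.prod_congr rfl h1]
  simp only [add_assoc, h2]
  ring

theorem burstCofactor_coeff {F R : Type*} [Field F] [CommRing R] [IsDomain R] [Algebra F R]
    (q a : F) (b : R) {r m t : ℕ} (ht : t < m) (s : ℕ) :
    (burstCofactor (algebraMap F R q) (algebraMap F R a) b r m t).coeff s =
      algebraMap F R ((burstCofactor q a 1 r m t).coeff s) * b ^ (m - 1 - s) := by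
  have h : burstCofactor (algebraMap F R q) (algebraMap F R a) b r m t =
      ((burstCofactor q a 1 r m t).map (algebraMap F R)).scaleRoots b := by
    simp only [burstCofactor, Polynomial.map_mul, Polynomial.map_prod, Polynomial.map_sub, map_X,
      map_C, one_mul, ← map_pow, mul_scaleRoots_of_noZeroDivisors, prod_X_sub_C_scaleRoots]
  rw [h, coeff_scaleRoots, coeff_map, natDegree_map, burstCofactor_natDegree _ _ _ ht]

/-- The coefficient matrix of the cofactors `burstCofactor q a b r m t` for `t < m`. -/
noncomputable def cofactorMatrix {R : Type*} [CommRing R] (q a b : R) (r m : ℕ) :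
    Matrix (Fin m) (Fin m) R :=
  Matrix.of fun t s => (burstCofactor q a b r m t).coeff s

theorem det_cofactorMatrix {F R : Type*} [Field F] [CommRing R] [IsDomain R] [Algebra F R]
    (q a : F) (b : R) (r m : ℕ) :
    (cofactorMatrix (algebraMap F R q) (algebraMap F R a) b r m).det =
      (∏ s : Fin m, b ^ (m - 1 - (s : ℕ))) *
        algebraMap F R (cofactorMatrix q a 1 r m).det := by
  rw [RingHom.map_det, ← Matrix.det_mul_row]
  congr 1
  ext t s
  simp [cofactorMatrix, burstCofactor_coeff q a b t.2, mul_comm]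

theorem sum_cofactorMatrix_mul_echelonBlock {R : Type*} [CommRing R] [Nontrivial R] {q a : R}
    (hqa : q * a = 1) (b : R) {r m : ℕ} (hm : m ≤ r) (t : Fin m) (j : Fin r) :
    ∑ s, cofactorMatrix q a b r m t s * echelonBlock q b r m s j =
      (burstPoly q (b * a ^ (t : ℕ)) (r - 1)).coeff j := by
  have hlt : (burstCofactor q a b r m t).natDegree < m := by
    rw [burstCofactor_natDegree _ _ _ t.2]; have := t.2; omega
  rw [← burstCofactor_mul_burstPoly hqa b t.2 hm,
    (burstCofactor q a b r m t).as_sum_range' m hlt, Finset.sum_mul, finsetSum_coeff,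
    ← Fin.sum_univ_eq_sum_range
      (fun s => (monomial s ((burstCofactor q a b r m t).coeff s) * burstPoly q b (r - m)).coeff j)]
  refine Finset.sum_congr rfl fun s _ => ?_
  rw [← C_mul_X_pow_eq_monomial, mul_assoc, coeff_C_mul, coeff_X_pow_mul']
  simp [cofactorMatrix, echelonBlock]

/-- A left kernel vector would be a linear relation among the polynomials `burstPoly q (a ^ t) (r -
1)`. Dividing by their nonzero common coefficients leaves a Vandermonde relation in the distinct
points `a ^ t`. -/
theorem det_cofactorMatrix_ne_zero {F : Type*} [Field F] {q a : F} {r : ℕ}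
    (hinj : ∀ i < r, ∀ j < r, q ^ i = q ^ j → i = j) (hqa : q * a = 1) {m : ℕ} (hm : m ≤ r) :
    (cofactorMatrix q a 1 r m).det ≠ 0 := by
  have hq : q ≠ 0 := left_ne_zero_of_mul_eq_one hqa
  have ha : a = q⁻¹ := eq_inv_of_mul_eq_one_right hqa
  intro h
  obtain ⟨v, hv, hv0⟩ := Matrix.exists_vecMul_eq_zero_iff.2 h
  apply hv
  refine Matrix.eq_zero_of_forall_pow_sum_mul_pow_eq_zero
    (f := fun t : Fin m => a ^ (t : ℕ)) (fun s t hst => ?_) fun k => ?_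
  · simp only [ha, inv_pow, inv_inj] at hst
    exact Fin.ext (hinj _ (s.2.trans_le hm) _ (t.2.trans_le hm) hst)
  · have hk : (k : ℕ) < r := k.2.trans_le hm
    have hc := burstPoly_coeff_ne_zero hinj hq (n := r - 1) (by omega) (Nat.sub_le (r - 1) k)
    have h1 (t : Fin m) := sum_cofactorMatrix_mul_echelonBlock hqa 1 hm t
      ⟨r - 1 - k, by omega⟩
    have h2 (t : Fin m) : (burstPoly q (1 * a ^ (t : ℕ)) (r - 1)).coeff (r - 1 - k) =
        (burstPoly q 1 (r - 1)).coeff (r - 1 - k) * (a ^ (t : ℕ)) ^ (k : ℕ) := by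
      have := burstPoly_coeff (R := F) q (a ^ (t : ℕ)) (r - 1) (r - 1 - k)
      rw [show r - 1 - (r - 1 - k) = (k : ℕ) by omega] at this
      rwa [one_mul]
    refine (mul_eq_zero.1 ?_).resolve_left hc
    calc _ = ∑ t, v t * ∑ s, cofactorMatrix q a 1 r m t s *
          echelonBlock q 1 r m s ⟨r - 1 - k, by omega⟩ := by
          rw [Finset.mul_sum]
          refine Finset.sum_congr rfl fun t _ => ?_
          rw [h1, h2]
          ring
      _ = ∑ s, (∑ t, v t * cofactorMatrix q a 1 r m t s) *
          echelonBlock q 1 r m s ⟨r - 1 - k, by omega⟩ := by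
          simp only [Finset.mul_sum, Finset.sum_mul, ← mul_assoc]
          exact Finset.sum_comm
      _ = 0 := Finset.sum_eq_zero fun s _ => by
          rw [show ∑ t, v t * cofactorMatrix q a 1 r m t s = 0 from congrFun hv0 s, zero_mul]

/-! ### Products and determinants over blocks -/

theorem finSigmaFinEquiv_lt_iff {n : ℕ} {μ : Fin n → ℕ} (x y : (i : Fin n) × Fin (μ i)) :
    finSigmaFinEquiv x < finSigmaFinEquiv y ↔
      x.1 < y.1 ∨ (x.1 = y.1 ∧ (x.2 : ℕ) < y.2) := by
  have key (x y : (i : Fin n) × Fin (μ i)) (h : x.1 < y.1) :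
      finSigmaFinEquiv x < finSigmaFinEquiv y := by
    let g : ℕ → ℕ := fun i => if hi : i < n then μ ⟨i, hi⟩ else 0
    have hg (z : Fin n) : ∑ i : Fin z, μ (Fin.castLE z.2.le i) = ∑ i ∈ Finset.range z, g i := by
      rw [← Fin.sum_univ_eq_sum_range]
      refine Finset.sum_congr rfl fun i _ => ?_
      simp only [g, dif_pos (i.2.trans z.2)]
      rfl
    rw [Fin.lt_def, finSigmaFinEquiv_apply, finSigmaFinEquiv_apply, hg, hg]
    have h1 : ∑ i ∈ Finset.range (x.1 + 1), g i ≤ ∑ i ∈ Finset.range y.1, g i :=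
      Finset.sum_le_sum_of_subset (Finset.range_mono h)
    rw [Finset.sum_range_succ, show g x.1 = μ x.1 from dif_pos x.1.2] at h1
    have := x.2.2
    omega
  rcases lt_trichotomy x.1 y.1 with h | h | h
  · simp [key x y h, h]
  · obtain ⟨i, s⟩ := x
    obtain ⟨k, t⟩ := y
    obtain rfl : i = k := h
    rw [Fin.lt_def, finSigmaFinEquiv_apply, finSigmaFinEquiv_apply]
    simp
  · simp [(key y x h).not_gt, h.not_gt, h.ne']

/-- The order is lexicographic, so a pair of indices lies in one block or in two different ones. -/
theorem prod_Ioi_finSigmaFinEquiv {M : Type*} [CommMonoid M] {n r : ℕ} {μ : Fin n → ℕ}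
    (hμ : ∑ i, μ i = r) (f : (i : Fin n) × Fin (μ i) → (i : Fin n) × Fin (μ i) → M) :
    ∏ a : Fin r, ∏ b ∈ Finset.Ioi a, f (finSigmaFinEquiv.symm (Fin.cast hμ.symm a))
        (finSigmaFinEquiv.symm (Fin.cast hμ.symm b)) =
      (∏ i, ∏ s, ∏ t ∈ Finset.Ioi s, f ⟨i, s⟩ ⟨i, t⟩) *
        ∏ i, ∏ k ∈ Finset.Ioi i, ∏ s, ∏ t, f ⟨i, s⟩ ⟨k, t⟩ := by
  subst hμ
  have h {p : ℕ} (a : Fin p) (g : Fin p → M) :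
      ∏ b ∈ Finset.Ioi a, g b = ∏ b, if a < b then g b else 1 := by
    rw [← Finset.prod_filter, Finset.filter_lt_eq_Ioi]
  have hsplit (i : Fin n) (s : Fin (μ i)) :
      ∏ b ∈ Finset.Ioi (finSigmaFinEquiv ⟨i, s⟩), f ⟨i, s⟩ (finSigmaFinEquiv.symm b) =
        (∏ t ∈ Finset.Ioi s, f ⟨i, s⟩ ⟨i, t⟩) * ∏ k ∈ Finset.Ioi i, ∏ t, f ⟨i, s⟩ ⟨k, t⟩ := by
    have hi : ∏ t ∈ Finset.Ioi s, f ⟨i, s⟩ ⟨i, t⟩ =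
        ∏ k, if i = k then ∏ t : Fin (μ k), (if (s : ℕ) < t then f ⟨i, s⟩ ⟨k, t⟩ else 1) else 1 := by
      rw [Fintype.prod_eq_single i fun k hk => if_neg hk.symm, if_pos rfl, h]
      rfl
    rw [hi, h, h, ← Equiv.prod_comp finSigmaFinEquiv, Fintype.prod_sigma,
      ← Finset.prod_mul_distrib]
    refine Finset.prod_congr rfl fun k _ => ?_
    simp only [finSigmaFinEquiv_lt_iff, Equiv.symm_apply_apply]
    rcases lt_trichotomy i k with hik | hik | hik
    · simp [hik, hik.ne]
    · simp [hik]
    · simp [hik.not_gt, hik.ne']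
  simp only [Fin.cast_eq_self]
  rw [← Equiv.prod_comp finSigmaFinEquiv, Fintype.prod_sigma, ← Finset.prod_mul_distrib]
  refine Finset.prod_congr rfl fun i _ => ?_
  rw [Finset.prod_comm, ← Finset.prod_mul_distrib]
  refine Finset.prod_congr rfl fun s _ => ?_
  rw [Equiv.symm_apply_apply, hsplit]

theorem det_blockDiagonal'_eq_prod {R : Type*} [CommRing R] {n : ℕ} {μ : Fin n → ℕ}
    (M : ∀ i, Matrix (Fin (μ i)) (Fin (μ i)) R) :
    (Matrix.blockDiagonal' M).det = ∏ i, (M i).det := by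
  rw [Matrix.BlockTriangular.det_fintype (Matrix.blockTriangular_blockDiagonal' M)]
  refine Finset.prod_congr rfl fun i _ => ?_
  rw [← Matrix.det_submatrix_equiv_self (Equiv.sigmaSubtype i).symm]
  congr 1
  ext s t
  simp [Matrix.toSquareBlock_def, Matrix.blockDiagonal'_apply, Equiv.sigmaSubtype]

/-! ### Reduction to the Vandermonde determinant -/

theorem det_burstPoly_coeff {F R : Type*} [Field F] [CommRing R] [IsDomain R] [Algebra F R]
    (q : F) {r : ℕ} (c : Fin r → R) :
    (Matrix.of fun i j : Fin r => (burstPoly (algebraMap F R q) (c i) (r - 1)).coeff j).det =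
      algebraMap F R (((Equiv.Perm.sign (Fin.revPerm (n := r)) : ℤ) : F) *
        ∏ j : Fin r, (burstPoly q 1 (r - 1)).coeff j) *
        ∏ i, ∏ j ∈ Finset.Ioi i, (c j - c i) := by
  have h : (Matrix.of fun i j : Fin r =>
      (burstPoly (algebraMap F R q) (c i) (r - 1)).coeff (j : ℕ)) = Matrix.of fun i (j : Fin r) =>
        algebraMap F R ((burstPoly q 1 (r - 1)).coeff j) *
          (Matrix.vandermonde c).submatrix id Fin.revPerm i j := by
    ext i j
    simp only [Matrix.of_apply, burstPoly_coeff, Matrix.submatrix_apply, Matrix.vandermonde_apply,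
      Fin.revPerm_apply, Fin.val_rev, id]
    congr 2
    omega
  rw [h, Matrix.det_mul_row, Matrix.det_permute', Matrix.det_vandermonde]
  simp only [map_mul, map_prod, map_intCast]
  ring

theorem stackedMatrix_apply_symm {R : Type*} [CommRing R] {l r : ℕ} (μ : Fin (l + 1) → ℕ)
    (hμ : ∑ i, μ i = r) (q : R) (β : Fin (l + 1) → R) (p : (i : Fin (l + 1)) × Fin (μ i))
    (j : Fin r) :
    stackedMatrix μ hμ q β (((finCongr hμ.symm).trans finSigmaFinEquiv.symm).symm p) j =
      echelonBlock q (β p.1) r (μ p.1) p.2 j := by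
  have h : finSigmaFinEquiv.symm (Fin.cast hμ.symm
      (((finCongr hμ.symm).trans finSigmaFinEquiv.symm).symm p)) = p :=
    Equiv.apply_symm_apply ((finCongr hμ.symm).trans finSigmaFinEquiv.symm) p
  simp only [stackedMatrix, Matrix.of_apply]
  rw [h]

theorem cofactorMatrix_mul_stackedMatrix {R : Type*} [CommRing R] [Nontrivial R] {q a : R}
    (hqa : q * a = 1) {l r : ℕ} {μ : Fin (l + 1) → ℕ} (hμ : ∑ i, μ i = r)
    (β : Fin (l + 1) → R) :
    (Matrix.blockDiagonal' fun i => cofactorMatrix q a (β i) r (μ i)).submatrix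
        ((finCongr hμ.symm).trans finSigmaFinEquiv.symm)
        ((finCongr hμ.symm).trans finSigmaFinEquiv.symm) * stackedMatrix μ hμ q β =
      Matrix.of fun x j : Fin r => (burstPoly q
        (β (finSigmaFinEquiv.symm (Fin.cast hμ.symm x)).1 *
          a ^ ((finSigmaFinEquiv.symm (Fin.cast hμ.symm x)).2 : ℕ)) (r - 1)).coeff j := by
  ext x j
  rw [Matrix.mul_apply, Matrix.of_apply]
  obtain ⟨⟨i, t⟩, rfl⟩ := ((finCongr hμ.symm).trans finSigmaFinEquiv.symm).symm.surjective x
  rw [← Equiv.sum_comp ((finCongr hμ.symm).trans finSigmaFinEquiv.symm).symm, Fintype.sum_sigma,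
    Fintype.sum_eq_single i]
  · have hm : μ i ≤ r := hμ ▸ Finset.single_le_sum (fun _ _ => Nat.zero_le _) (Finset.mem_univ i)
    have h : finSigmaFinEquiv.symm (Fin.cast hμ.symm
        (((finCongr hμ.symm).trans finSigmaFinEquiv.symm).symm ⟨i, t⟩)) = ⟨i, t⟩ :=
      Equiv.apply_symm_apply ((finCongr hμ.symm).trans finSigmaFinEquiv.symm) _
    simp only [stackedMatrix_apply_symm, Matrix.submatrix_apply,
      Equiv.apply_symm_apply, Matrix.blockDiagonal'_apply_eq]
    rw [h]
    exact sum_cofactorMatrix_mul_echelonBlock hqa (β i) hm t j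
  · intro k hk
    refine Finset.sum_eq_zero fun s _ => ?_
    simp [Matrix.blockDiagonal'_apply_ne _ _ _ hk.symm]

/-- Choosing `κ` before the domain `R` lets one constant serve both `F` and the polynomial ring. -/
theorem exists_const_det_stackedMatrix {F : Type*} [Field F] (l r : ℕ) {q : F}
    (hq : q ≠ 0) (hinj : ∀ i < r, ∀ j < r, q ^ i = q ^ j → i = j) (μ : Fin (l + 1) → ℕ)
    (hμ : ∑ i, μ i = r) :
    ∃ κ : F, κ ≠ 0 ∧ ∀ (R : Type*) [CommRing R] [IsDomain R] [Algebra F R]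
      (β : Fin (l + 1) → R), (∀ i, β i ≠ 0) →
        (stackedMatrix μ hμ (algebraMap F R q) β).det =
          algebraMap F R κ * ∏ i : Fin (l + 1), ∏ k ∈ Finset.Ioi i,
            ∏ s ∈ Finset.range (μ i), ∏ t ∈ Finset.range (μ k),
              (β k * algebraMap F R q ^ s - β i * algebraMap F R q ^ t) := by
  have hm (i) : μ i ≤ r := hμ ▸ Finset.single_le_sum (fun _ _ => Nat.zero_le _) (Finset.mem_univ i)
  obtain ⟨a, hqa⟩ : ∃ a, q * a = 1 := ⟨q⁻¹, mul_inv_cancel₀ hq⟩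
  have ha : a = q⁻¹ := eq_inv_of_mul_eq_one_right hqa
  have ha0 : a ≠ 0 := right_ne_zero_of_mul_eq_one hqa
  set D : F := ∏ i, (cofactorMatrix q a 1 r (μ i)).det with hD
  set E : F := ((Equiv.Perm.sign (Fin.revPerm (n := r)) : ℤ) : F) *
        ∏ j : Fin r, (burstPoly q 1 (r - 1)).coeff j with hE
  set V : F := ∏ i, ∏ s : Fin (μ i), ∏ t ∈ Finset.Ioi s, (a ^ (t : ℕ) - a ^ (s : ℕ)) with hV
  set W : F := ∏ i, ∏ k ∈ Finset.Ioi i, ∏ s : Fin (μ i), ∏ t : Fin (μ k),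
    (a ^ (s : ℕ) * a ^ (t : ℕ)) with hW
  have hD0 : D ≠ 0 := Finset.prod_ne_zero_iff.2 fun i _ =>
    det_cofactorMatrix_ne_zero hinj hqa (hm i)
  have hE0 : E ≠ 0 := by
    refine mul_ne_zero ?_ (Finset.prod_ne_zero_iff.2 fun j _ =>
      burstPoly_coeff_ne_zero hinj hq (by have := j.2; omega) (by have := j.2; omega))
    rcases Int.units_eq_one_or (Equiv.Perm.sign (Fin.revPerm (n := r))) with h | h <;> simp [h]
  have hV0 : V ≠ 0 := by
    simp only [hV, Finset.prod_ne_zero_iff, sub_ne_zero, ha, inv_pow, ne_eq, inv_inj]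
    intro i _ s _ t hst h
    have := hinj _ (t.2.trans_le (hm i)) _ (s.2.trans_le (hm i)) h
    exact (Finset.mem_Ioi.1 hst).ne' (Fin.ext this)
  have hW0 : W ≠ 0 := by
    simp [hW, Finset.prod_ne_zero_iff, ha0]
  refine ⟨E * V * W / D, by simp [hD0, hE0, hV0, hW0], fun R _ _ _ β hβ => ?_⟩
  have hinjR := FaithfulSMul.algebraMap_injective F R
  have hqaR : algebraMap F R q * algebraMap F R a = 1 := by rw [← map_mul, hqa, map_one]
  have key := congrArg Matrix.det (cofactorMatrix_mul_stackedMatrix hqaR hμ β)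
  rw [Matrix.det_mul, Matrix.det_submatrix_equiv_self, det_blockDiagonal'_eq_prod,
    det_burstPoly_coeff, ← hE] at key
  rw [prod_Ioi_finSigmaFinEquiv hμ (fun x y : (i : Fin (l + 1)) × Fin (μ i) =>
    β y.1 * algebraMap F R a ^ (y.2 : ℕ) - β x.1 * algebraMap F R a ^ (x.2 : ℕ))] at key
  simp only [det_cofactorMatrix, Finset.prod_mul_distrib] at key
  rw [← map_prod, ← hD] at key
  have hP : ∏ i, ∏ s : Fin (μ i), ∏ t ∈ Finset.Ioi s,
      (β i * algebraMap F R a ^ (t : ℕ) - β i * algebraMap F R a ^ (s : ℕ)) =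
        (∏ i, ∏ s : Fin (μ i), β i ^ (μ i - 1 - (s : ℕ))) * algebraMap F R V := by
    simp only [hV, map_prod, ← Finset.prod_mul_distrib]
    refine Finset.prod_congr rfl fun i _ => Finset.prod_congr rfl fun s _ => ?_
    simp only [← mul_sub, Finset.prod_mul_distrib, Finset.prod_const, Fin.card_Ioi, map_sub,
      map_pow]
  -- Extracting `a ^ s * a ^ t` from each factor swaps the exponents, since `a` is inverse to `q`.
  have hQ : ∏ i, ∏ k ∈ Finset.Ioi i, ∏ s : Fin (μ i), ∏ t : Fin (μ k),
      (β k * algebraMap F R a ^ (t : ℕ) - β i * algebraMap F R a ^ (s : ℕ)) =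
        algebraMap F R W * ∏ i : Fin (l + 1), ∏ k ∈ Finset.Ioi i,
            ∏ s ∈ Finset.range (μ i), ∏ t ∈ Finset.range (μ k),
              (β k * algebraMap F R q ^ s - β i * algebraMap F R q ^ t) := by
    simp only [hW, map_prod, ← Finset.prod_mul_distrib, Finset.prod_range]
    refine Finset.prod_congr rfl fun i _ => Finset.prod_congr rfl fun k _ =>
      Finset.prod_congr rfl fun s _ => Finset.prod_congr rfl fun t _ => ?_
    have hpow (i : ℕ) : algebraMap F R q ^ i * algebraMap F R a ^ i = 1 := by
      rw [← mul_pow, hqaR, one_pow]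
    rw [map_mul, map_pow, map_pow]
    linear_combination (-β k * algebraMap F R a ^ (t : ℕ)) * hpow s +
      (β i * algebraMap F R a ^ (s : ℕ)) * hpow t
  rw [hP, hQ] at key
  -- The same power product occurs on both sides of `key`; it can be cancelled because the `β i` are
  -- nonzero.
  have hB : ∏ i, ∏ s : Fin (μ i), β i ^ (μ i - 1 - (s : ℕ)) ≠ 0 := by
    simp [Finset.prod_ne_zero_iff, hβ]
  have hDR : algebraMap F R D ≠ 0 := by simpa using hinjR.ne hD0
  refine mul_left_cancel₀ (mul_ne_zero hB hDR) (key.trans ?_)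
  have hκ (B P : R) : B * algebraMap F R D * (algebraMap F R (E * V * W / D) * P) =
      B * (algebraMap F R E * algebraMap F R V * algebraMap F R W) * P := by
    rw [← mul_assoc, mul_assoc B, ← map_mul, mul_div_cancel₀ _ hD0, map_mul, map_mul]
  rw [hκ]
  ring

theorem mainTheorem3 {F : Type*} [Field F] [Finite F] (l r : ℕ) (α : F) (hα : α ≠ 0)
    (hord : r ≤ orderOf α) (μ : Fin (l + 1) → ℕ) (hpos : ∀ i, 0 < μ i)
    (hμ : ∑ i, μ i = r) :
    ∃ κ : F, κ ≠ 0 ∧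
      (∀ β : Fin (l + 1) → F, (∀ i, β i ≠ 0) →
        (stackedMatrix μ hμ α β).det =
          κ * ∏ i : Fin (l + 1), ∏ k ∈ Finset.Ioi i,
            ∏ s ∈ Finset.range (μ i), ∏ t ∈ Finset.range (μ k),
              (β k * α ^ s - β i * α ^ t)) ∧
      (stackedMatrix μ hμ (MvPolynomial.C α : MvPolynomial (Fin (l + 1)) F)
          MvPolynomial.X).det =
        MvPolynomial.C κ * ∏ i : Fin (l + 1), ∏ k ∈ Finset.Ioi i,
          ∏ s ∈ Finset.range (μ i), ∏ t ∈ Finset.range (μ k),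
            (MvPolynomial.X k * MvPolynomial.C α ^ s -
              MvPolynomial.X i * MvPolynomial.C α ^ t) := by
  obtain ⟨κ, hκ, h⟩ := exists_const_det_stackedMatrix l r hα (fun i hi j hj hij =>
    pow_injOn_Iio_orderOf (hi.trans_le hord) (hj.trans_le hord) hij) μ hμ
  exact ⟨κ, hκ, fun β hβ => h F β hβ, h _ MvPolynomial.X fun i => MvPolynomial.X_ne_zero i⟩
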